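/- Let $k\ge 2$ and let $P,Q\in\mathbb R[x]$ be two polynomials of degree exactly $k$, each of which has only real roots, all nonzero and of the same sign (all positive or all negative; the sign for $P$ may differ from the sign for $Q$). Write $P(x)=\sum_{j=0}^k\binom kj a_jx^j$ and $Q(x)=\sum_{j=0}^k\binom kj b_jx^j$, and let $$(P*Q)(x)=\sum_{j=0}^k\binom kj a_jb_jx^j$$ be their Schur–Szegő product. For a polynomial $R$ of degree $k$ with all roots real, nonzero and of the same sign, order the roots, repeated according to multiplicity, as $|x_1|\le|x_2|\le\dots\le|x_k|$ and define its logarithmic mesh by $$\operatorname{lmesh}(R)=\min_{1\le j\le k-1}\frac{|x_{j+1}|}{|x_j|}.$$ Then $P*Q$ also has degree $k$ and only real, nonzero roots of the same sign (so that $\operatorname{lmesh}(P*Q)$ is defined), and $$\operatorname{lmesh}(P*Q)\ge\max\bigl(\operatorname{lmesh}(P),\operatorname{lmesh}(Q)\bigr).$$ -/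

import Mathlib

open Polynomial

/-- All complex roots of the (nonzero) real polynomial `P` are real, and they all have the same
sign: either all are positive or all are negative. -/
structure HasRealRootsOfSameSign (P : ℝ[X]) : Prop where
  ne_zero : P ≠ 0
  real_rooted : P.Splits
  same_sign : (∀ x ∈ P.roots, 0 < x) ∨ (∀ x ∈ P.roots, x < 0)

/-- The coefficient `a_j` of `P` in the expansion `P = ∑_{j ≤ k} (k choose j) a_j x^j`. -/
noncomputable def binomCoeff (k : ℕ) (P : ℝ[X]) (j : ℕ) : ℝ :=
  P.coeff j / (k.choose j : ℝ)

/-- The coefficients `binomCoeff k P j` are indeed the coefficients of `P` in the binomial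
basis. -/
theorem sum_binomCoeff (k : ℕ) (P : ℝ[X]) (hP : P.natDegree ≤ k) :
    ∑ j ∈ Finset.range (k + 1), C ((k.choose j : ℝ) * binomCoeff k P j) * X ^ j = P := by
  conv_rhs => rw [P.as_sum_range_C_mul_X_pow' (Nat.lt_succ_of_le hP)]
  refine Finset.sum_congr rfl fun j hj => ?_
  have h : (k.choose j : ℝ) ≠ 0 :=
    Nat.cast_ne_zero.2 (Nat.choose_pos (Nat.lt_succ_iff.1 (Finset.mem_range.1 hj))).ne'
  rw [binomCoeff, mul_div_cancel₀ _ h]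

/-- The Schur–Szegő product, with respect to the degree `k`, of
`P = ∑_{j ≤ k} (k choose j) a_j x^j` and `Q = ∑_{j ≤ k} (k choose j) b_j x^j`:
the polynomial `∑_{j ≤ k} (k choose j) a_j b_j x^j`. -/
noncomputable def schurSzego (k : ℕ) (P Q : ℝ[X]) : ℝ[X] :=
  ∑ j ∈ Finset.range (k + 1),
    C ((k.choose j : ℝ) * binomCoeff k P j * binomCoeff k Q j) * X ^ j

/-- The absolute values of the real roots of `P`, counted with multiplicity, in nondecreasing
order. -/
noncomputable def rootModuli (P : ℝ[X]) : List ℝ :=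
  (P.roots.map fun x => |x|).sort (· ≤ ·)

/-- The logarithmic mesh: the least ratio of two consecutive root moduli. The infimum is over a
finite index set, which is nonempty (so that the infimum is a minimum) as soon as there are at
least two roots. -/
noncomputable def lmesh (P : ℝ[X]) : ℝ :=
  ⨅ j : Fin ((rootModuli P).length - 1),
    ((rootModuli P)[j.1 + 1]'(by omega)) / ((rootModuli P)[j.1]'(by omega))

/-!
For fixed `z`, the value of `P * Q` at `z` is a bilinear pairing of `P` with `Q (z ·)`. By the
theorem of Grace, Walsh and Szegő (obtained from Laguerre's theorem on polar derivatives) this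
pairing is nonzero as soon as `P` has no zero in a half-plane containing all `-z / r`, `r` a root of
`Q`. Rotating the half-plane about the origin shows that the roots of `P * Q` are real and of the
same sign.

If `1 < q < lmesh P`, then `P (q z) / P z` maps one of the two half-planes bounded by the real axis
to the upper one, so `P (q z) + i P z` has no zero there. Since the Schur–Szegő product commutes
with dilations, the pairing of this polynomial with `Q (x ·)`, for real `x`, is
`(P * Q) (q x) + i (P * Q) x`: hence `P * Q` has no two roots of ratio `q`. The same argument with
`z P' z` in place of `P (q z)` excludes double roots of `P * Q` when `P` has none.
-/

open scoped ComplexConjugate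

section ApolarPairing

variable {K : Type*} [Field K]

/-- The apolar pairing `∑ j ≤ k, F_j G_j / (k choose j)` of polynomials of degree at most `k`.
It is the classical apolarity form up to reversing `G` and alternating its signs; with this
normalization the values of a Schur–Szegő product are pairings (see `aeval_schurSzego`). -/
noncomputable def apolarPairing (k : ℕ) : LinearMap.BilinForm K K[X] :=
  ∑ j ∈ Finset.range (k + 1),
    (k.choose j : K)⁻¹ • (LinearMap.mul K K).compl₁₂ (lcoeff K j) (lcoeff K j)

theorem apolarPairing_apply (k : ℕ) (F G : K[X]) :
    apolarPairing k F G
      = ∑ j ∈ Finset.range (k + 1), F.coeff j * G.coeff j / (k.choose j : K) := by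
  simp [apolarPairing, LinearMap.sum_apply, div_eq_inv_mul]

end ApolarPairing

section PolarDerivative

/-- The polar derivative `n F + (ζ - X) F'` of `F`, regarded as a polynomial of degree `n`, with
respect to the pole `ζ`. -/
noncomputable def polarDerivative {R : Type*} [CommRing R] (n : ℕ) (ζ : R) (F : R[X]) : R[X] :=
  (n : R[X]) * F + (C ζ - X) * derivative F

theorem coeff_X_mul_derivative {R : Type*} [CommSemiring R] (F : R[X]) (j : ℕ) :
    (X * derivative F).coeff j = j * F.coeff j := by
  cases j with
  | zero => simp
  | succ j => rw [coeff_X_mul, coeff_derivative, Nat.cast_succ, mul_comm]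

theorem coeff_polarDerivative {R : Type*} [CommRing R] (n : ℕ) (ζ : R) (F : R[X]) (j : ℕ) :
    (polarDerivative n ζ F).coeff j
      = (n - j) * F.coeff j + ζ * ((j + 1) * F.coeff (j + 1)) := by
  rw [polarDerivative, coeff_add, coeff_natCast_mul, sub_mul, coeff_sub, coeff_X_mul_derivative,
    coeff_C_mul, coeff_derivative]
  ring

theorem natDegree_polarDerivative_le {R : Type*} [CommRing R] {n : ℕ} (ζ : R) {F : R[X]}
    (hF : F.natDegree ≤ n + 1) : (polarDerivative (n + 1) ζ F).natDegree ≤ n := by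
  rw [natDegree_le_iff_coeff_eq_zero] at hF ⊢
  intro j hj
  rw [coeff_polarDerivative, hF (j + 1) (by omega)]
  rcases (Nat.succ_le_of_lt hj).eq_or_lt with rfl | hj'
  · simp
  · simp [hF j hj']

theorem cast_choose_add_one_mul_sub {R : Type*} [Ring R] {n j : ℕ} (hj : j ≤ n) :
    ((n + 1).choose j : R) * (n + 1 - j) = n.choose j * (n + 1) := by
  have h := congrArg (Nat.cast : ℕ → R) (Nat.choose_mul_succ_eq n j)
  rw [Nat.cast_mul, Nat.cast_mul, Nat.cast_sub (hj.trans n.le_succ)] at h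
  exact_mod_cast h.symm

theorem apolarPairing_polarDerivative {K : Type*} [Field K] [CharZero K] {n : ℕ} (ζ : K)
    (F : K[X]) {G : K[X]} (hG : G.natDegree ≤ n) :
    apolarPairing n (polarDerivative (n + 1) ζ F) G
      = (n + 1) * apolarPairing (n + 1) F ((1 + C ζ * X) * G) := by
  have hG' : G.coeff (n + 1) = 0 := coeff_eq_zero_of_natDegree_lt (by omega)
  have hXG : apolarPairing (n + 1) F (X * G) = ∑ j ∈ Finset.range (n + 1),
      F.coeff (j + 1) * G.coeff j / ((n + 1).choose (j + 1) : K) := by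
    simp [apolarPairing_apply, Finset.sum_range_succ' _ (n + 1), coeff_X_mul]
  rw [add_mul 1 (C ζ * X), one_mul, mul_assoc, ← smul_eq_C_mul, map_add, map_smul, hXG,
    apolarPairing_apply, apolarPairing_apply, Finset.sum_range_succ _ (n + 1), hG', mul_zero,
    zero_div, add_zero, smul_eq_mul, Finset.mul_sum, ← Finset.sum_add_distrib, Finset.mul_sum]
  refine Finset.sum_congr rfl fun j hj => ?_
  have hjn : j ≤ n := Nat.lt_succ_iff.1 (Finset.mem_range.1 hj)
  have hc : (n.choose j : K) ≠ 0 := Nat.cast_ne_zero.2 (Nat.choose_pos hjn).ne'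
  have hc₀ : ((n + 1).choose j : K) ≠ 0 :=
    Nat.cast_ne_zero.2 (Nat.choose_pos (hjn.trans n.le_succ)).ne'
  have hc₁ : ((n + 1).choose (j + 1) : K) ≠ 0 :=
    Nat.cast_ne_zero.2 (Nat.choose_pos (Nat.succ_le_succ hjn)).ne'
  have h₀ := cast_choose_add_one_mul_sub (R := K) hjn
  have h₁ : (n + 1) * (n.choose j : K) = (n + 1).choose (j + 1) * (j + 1) := by
    exact_mod_cast Nat.add_one_mul_choose_eq n j
  rw [coeff_polarDerivative]
  push_cast
  field_simp
  linear_combination F.coeff j * G.coeff j * (n + 1).choose (j + 1) * h₀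
    - ζ * F.coeff (j + 1) * G.coeff j * (n + 1).choose j * h₁

end PolarDerivative

section GraceSzego

theorem nat_mul_sq_norm_le_sum_sq_norm {E : Type*} [NormedAddCommGroup E] [InnerProductSpace ℝ E]
    {s : Multiset E} {n : ℕ} {u : E} (hcard : s.card ≤ n) (hsum : s.sum = (n : ℝ) • u) :
    n * ‖u‖ ^ 2 ≤ (s.map fun v => ‖v‖ ^ 2).sum := by
  have hcard' : (s.card : ℝ) ≤ n := by exact_mod_cast hcard
  have hinner : (s.map fun v => inner ℝ u v).sum = n * ‖u‖ ^ 2 := by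
    rw [← real_inner_self_eq_norm_sq, ← real_inner_smul_right, ← hsum]
    exact (map_multiset_sum (innerSL ℝ u) s).symm
  calc n * ‖u‖ ^ 2
      ≤ 2 * (n * ‖u‖ ^ 2) - s.card * ‖u‖ ^ 2 := by nlinarith [sq_nonneg ‖u‖]
    _ = (s.map fun v => 2 * inner ℝ u v - ‖u‖ ^ 2).sum := by
        rw [Multiset.sum_map_sub, Multiset.sum_map_mul_left, hinner, Multiset.map_const',
          Multiset.sum_replicate, nsmul_eq_mul]
    _ ≤ (s.map fun v => ‖v‖ ^ 2).sum := Multiset.sum_map_le_sum_map _ _ fun v _ => by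
        linarith [sq_nonneg ‖u - v‖, norm_sub_sq_real u v]

/-- The half-plane `{z | c ≤ Im (ω z)}`; every closed half-plane of `ℂ` has this form for some
`ω ≠ 0`. -/
def closedHalfPlane (ω : ℂ) (c : ℝ) : Set ℂ :=
  {z | c ≤ (ω * z).im}

theorem im_mul_conj_inv (ω z : ℂ) : (ω * conj z⁻¹).im = (ω * z).im * ‖z⁻¹‖ ^ 2 := by
  rw [← Complex.normSq_eq_norm_sq, Complex.inv_def, map_mul, Complex.conj_conj,
    Complex.conj_ofReal, ← mul_assoc, Complex.im_mul_ofReal, ← Complex.inv_def, map_inv₀]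

theorem sum_map_im_mul_conj (ω : ℂ) (s : Multiset ℂ) :
    (s.map fun v => (ω * conj v).im).sum = (ω * conj s.sum).im :=
  (map_multiset_sum ((Complex.imAddGroupHom.comp (AddMonoidHom.mulLeft ω)).comp
    (starRingEnd ℂ : ℂ →+ ℂ)) s).symm

theorem sum_inv_sub_roots_eq_of_eval_polarDerivative_eq_zero {K : Type*} [Field K] {n : ℕ}
    {F : K[X]} (hF : F.Splits) {ζ z : K} (hz : F.eval z ≠ 0) (hzζ : z ≠ ζ)
    (h : (polarDerivative n ζ F).eval z = 0) :
    (F.roots.map fun r => (z - r)⁻¹).sum = n * (z - ζ)⁻¹ := by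
  have hlog := hF.eval_derivative_div_eval_of_ne_zero hz
  simp only [one_div] at hlog
  simp only [polarDerivative, eval_add, eval_mul, eval_natCast, eval_sub, eval_C, eval_X] at h
  rw [← hlog, div_eq_iff hz, mul_right_comm, ← div_eq_mul_inv, eq_div_iff (sub_ne_zero.2 hzζ)]
  linear_combination -h

/-- Laguerre's theorem. The logarithmic derivative of `F` is a sum of points `(z - r)⁻¹`, each in
the disc which is the image of the complement of the half-plane under `r ↦ (z - r)⁻¹`. A zero of
the polar derivative makes `(z - ζ)⁻¹` their mean, up to adjoining zeros for roots at infinity. -/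
theorem eval_polarDerivative_ne_zero {n : ℕ} (hn : n ≠ 0) {F : ℂ[X]} (hF : F.natDegree ≤ n)
    {ω : ℂ} {c : ℝ} (h : ∀ z ∈ closedHalfPlane ω c, F.eval z ≠ 0) {ζ z : ℂ}
    (hζ : c ≤ (ω * ζ).im) (hz : c ≤ (ω * z).im) : (polarDerivative n ζ F).eval z ≠ 0 := by
  intro hzero
  have hFz := h z hz
  have hn' : (n : ℂ) ≠ 0 := Nat.cast_ne_zero.2 hn
  have hzζ : z ≠ ζ := by
    rintro rfl
    exact mul_ne_zero hn' hFz (by simpa [polarDerivative] using hzero)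
  have hsum := sum_inv_sub_roots_eq_of_eval_polarDerivative_eq_zero (IsAlgClosed.splits F) hFz
    hzζ hzero
  set s := F.roots.map fun r => (z - r)⁻¹
  set u := (z - ζ)⁻¹
  have hs0 : s ≠ 0 := fun he => mul_ne_zero hn' (inv_ne_zero (sub_ne_zero.2 hzζ)) <| by
    rw [← hsum, he, Multiset.sum_zero]
  have hdisc : ∀ v ∈ s, ((ω * z).im - c) * ‖v‖ ^ 2 < (ω * conj v).im := by
    intro v hv
    obtain ⟨r, hr, rfl⟩ := Multiset.mem_map.1 hv
    have hr0 : F.eval r = 0 := (mem_roots'.1 hr).2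
    have hrc : (ω * r).im < c := lt_of_not_ge fun hc => h r hc hr0
    have hzr : z - r ≠ 0 := fun he => hFz (sub_eq_zero.1 he ▸ hr0)
    have hnorm : 0 < ‖(z - r)⁻¹‖ := norm_pos_iff.2 (inv_ne_zero hzr)
    rw [im_mul_conj_inv, mul_sub, Complex.sub_im]
    gcongr
  have hcard : s.card ≤ n := (Multiset.card_map _ _).trans_le ((card_roots' F).trans hF)
  have : 0 ≤ (ω * z).im - c := sub_nonneg.2 hz
  refine lt_irrefl (n * (ω * conj u).im) ?_
  calc n * (ω * conj u).im
      = ((ω * z).im - (ω * ζ).im) * (n * ‖u‖ ^ 2) := by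
        rw [im_mul_conj_inv, mul_sub, Complex.sub_im]; ring
    _ ≤ ((ω * z).im - c) * (n * ‖u‖ ^ 2) := by gcongr
    _ ≤ ((ω * z).im - c) * (s.map fun v => ‖v‖ ^ 2).sum := by
        gcongr
        exact nat_mul_sq_norm_le_sum_sq_norm hcard (by simpa using hsum)
    _ = (s.map fun v => ((ω * z).im - c) * ‖v‖ ^ 2).sum := Multiset.sum_map_mul_left.symm
    _ < (s.map fun v => (ω * conj v).im).sum := Multiset.sum_lt_sum_of_nonempty hs0 hdisc
    _ = n * (ω * conj u).im := by
        rw [sum_map_im_mul_conj, hsum, map_mul, map_natCast, mul_left_comm, ← nsmul_eq_mul,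
          Complex.im_nsmul, nsmul_eq_mul]

theorem natDegree_prod_one_add_C_mul_X_le {R : Type*} [CommSemiring R] (s : Multiset R) :
    (s.map fun ζ => 1 + C ζ * X).prod.natDegree ≤ s.card := by
  induction s using Multiset.induction with
  | empty => simp
  | cons ζ s ih =>
    rw [Multiset.map_cons, Multiset.prod_cons, Multiset.card_cons, add_comm s.card, add_comm 1]
    exact natDegree_mul_le_of_le (natDegree_linear_le (a := ζ) (b := 1)) ih

/-- The Grace–Walsh–Szegő theorem: each factor `1 + ζ X` moves across the pairing as a polar
derivative, which stays zero-free on the half-plane by Laguerre's theorem. -/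
theorem apolarPairing_prod_one_add_C_mul_X_ne_zero {ω : ℂ} {c : ℝ}
    (hne : (closedHalfPlane ω c).Nonempty) {s : Multiset ℂ} (hs : ∀ ζ ∈ s, ζ ∈ closedHalfPlane ω c)
    {F : ℂ[X]} (hF : F.natDegree ≤ s.card) (h : ∀ z ∈ closedHalfPlane ω c, F.eval z ≠ 0) :
    apolarPairing s.card F (s.map fun ζ => 1 + C ζ * X).prod ≠ 0 := by
  induction s using Multiset.induction generalizing F with
  | empty =>
    obtain ⟨z, hz⟩ := hne
    rw [Multiset.card_zero, Nat.le_zero] at hF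
    have hFz := h z hz
    rw [eq_C_of_natDegree_eq_zero hF, eval_C] at hFz
    simpa [apolarPairing_apply] using hFz
  | cons ζ s ih =>
    rw [Multiset.card_cons] at hF ⊢
    rw [Multiset.map_cons, Multiset.prod_cons]
    have hpolar := ih (fun ξ hξ => hs ξ (Multiset.mem_cons_of_mem hξ))
      (natDegree_polarDerivative_le ζ hF) fun z hz =>
        eval_polarDerivative_ne_zero s.card.succ_ne_zero hF h (hs ζ (Multiset.mem_cons_self ζ s)) hz
    rw [apolarPairing_polarDerivative ζ F (natDegree_prod_one_add_C_mul_X_le s)] at hpolar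
    exact right_ne_zero_of_mul hpolar

theorem comp_C_mul_X_eq_C_mul_prod {K : Type*} [Field K] {Q : K[X]} (hQ : Q.Splits)
    (hQ0 : Q.coeff 0 ≠ 0) (x : K) :
    Q.comp (C x * X) = C (Q.coeff 0) * (Q.roots.map fun r => 1 + C (-(x / r)) * X).prod := by
  have hfactor : ∀ r ∈ Q.roots, C x * X - C r = C (-r) * (1 + C (-(x / r)) * X) := by
    intro r hr
    have hr0 : r ≠ 0 := by
      rintro rfl
      exact hQ0 (by simpa [coeff_zero_eq_eval_zero] using (mem_roots'.1 hr).2)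
    rw [mul_add, ← mul_assoc, ← C_mul, neg_mul_neg, mul_div_cancel₀ _ hr0]
    simp only [C_neg]
    ring
  conv_lhs => rw [hQ.eq_prod_roots]
  rw [mul_comp, C_comp, multiset_prod_comp, Multiset.map_map,
    coeff_zero_eq_eval_zero, hQ.eval_eq_prod_roots]
  simp only [Function.comp_def, sub_comp, X_comp, C_comp, zero_sub]
  rw [Multiset.map_congr rfl hfactor, Multiset.prod_map_mul, C_mul, map_multiset_prod,
    Multiset.map_map, mul_assoc]
  rfl

/-- Szegő's theorem: the roots `1 / ζ` of the Grace–Walsh–Szegő theorem are those of `Q (x ·)`. -/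
theorem apolarPairing_comp_C_mul_X_ne_zero {ω : ℂ} {c : ℝ} (hne : (closedHalfPlane ω c).Nonempty)
    {F Q : ℂ[X]} (hF : F.natDegree ≤ Q.natDegree) (h : ∀ z ∈ closedHalfPlane ω c, F.eval z ≠ 0)
    (hQ0 : Q.coeff 0 ≠ 0) {x : ℂ} (hQ : ∀ r ∈ Q.roots, -(x / r) ∈ closedHalfPlane ω c) :
    apolarPairing Q.natDegree F (Q.comp (C x * X)) ≠ 0 := by
  have hsplits := IsAlgClosed.splits Q
  have hcard : (Q.roots.map fun r => -(x / r)).card = Q.natDegree := by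
    rw [Multiset.card_map, hsplits.natDegree_eq_card_roots]
  have hgrace := apolarPairing_prod_one_add_C_mul_X_ne_zero hne (s := Q.roots.map fun r => -(x / r))
    (Multiset.forall_mem_map_iff.2 hQ) (F := F) (by rwa [hcard]) h
  rw [hcard, Multiset.map_map] at hgrace
  rw [comp_C_mul_X_eq_C_mul_prod hsplits hQ0, ← smul_eq_C_mul, map_smul]
  exact smul_ne_zero hQ0 hgrace

end GraceSzego

section SchurSzego

theorem coeff_schurSzego (k : ℕ) (P Q : ℝ[X]) (j : ℕ) :
    (schurSzego k P Q).coeff j = P.coeff j * Q.coeff j / k.choose j := by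
  simp only [schurSzego, binomCoeff, finsetSum_coeff, coeff_C_mul_X_pow, Finset.sum_ite_eq,
    Finset.mem_range]
  rcases lt_or_ge k j with hj | hj
  · simp [Nat.choose_eq_zero_of_lt hj]
  · have hc : (k.choose j : ℝ) ≠ 0 := Nat.cast_ne_zero.2 (Nat.choose_pos hj).ne'
    rw [if_pos (Nat.lt_succ_of_le hj), mul_div_cancel₀ _ hc, mul_div_assoc]

theorem schurSzego_comm (k : ℕ) (P Q : ℝ[X]) : schurSzego k P Q = schurSzego k Q P := by
  ext j
  rw [coeff_schurSzego, coeff_schurSzego, mul_comm]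

theorem natDegree_schurSzego_le (k : ℕ) (P Q : ℝ[X]) : (schurSzego k P Q).natDegree ≤ k := by
  refine natDegree_le_iff_coeff_eq_zero.2 fun j hj => ?_
  rw [coeff_schurSzego, Nat.choose_eq_zero_of_lt hj, Nat.cast_zero, div_zero]

theorem coeff_natDegree_schurSzego_ne_zero {P Q : ℝ[X]} (hP : P ≠ 0) (hQ : Q ≠ 0)
    (hdeg : P.natDegree = Q.natDegree) : (schurSzego Q.natDegree P Q).coeff Q.natDegree ≠ 0 := by
  rw [coeff_schurSzego, Nat.choose_self, Nat.cast_one, div_one]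
  exact mul_ne_zero (hdeg ▸ leadingCoeff_ne_zero.2 hP) (leadingCoeff_ne_zero.2 hQ)

theorem natDegree_schurSzego {P Q : ℝ[X]} (hP : P ≠ 0) (hQ : Q ≠ 0)
    (hdeg : P.natDegree = Q.natDegree) : (schurSzego Q.natDegree P Q).natDegree = Q.natDegree :=
  natDegree_eq_of_le_of_coeff_ne_zero (natDegree_schurSzego_le _ P Q)
    (coeff_natDegree_schurSzego_ne_zero hP hQ hdeg)

theorem schurSzego_comp_C_mul_X (k : ℕ) (P Q : ℝ[X]) (q : ℝ) :
    schurSzego k (P.comp (C q * X)) Q = (schurSzego k P Q).comp (C q * X) := by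
  ext j
  simp only [coeff_schurSzego, comp_C_mul_X_coeff]
  ring

theorem schurSzego_X_mul_derivative (k : ℕ) (P Q : ℝ[X]) :
    schurSzego k (X * derivative P) Q = X * derivative (schurSzego k P Q) := by
  ext j
  simp only [coeff_schurSzego, coeff_X_mul_derivative]
  ring

theorem aeval_schurSzego {K : Type*} [Field K] [Algebra ℝ K] (k : ℕ) (P Q : ℝ[X]) (z : K) :
    aeval z (schurSzego k P Q)
      = apolarPairing k (P.map (algebraMap ℝ K)) ((Q.map (algebraMap ℝ K)).comp (C z * X)) := by
  rw [aeval_eq_sum_range' (Nat.lt_succ_of_le (natDegree_schurSzego_le k P Q)),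
    apolarPairing_apply]
  refine Finset.sum_congr rfl fun j _ => ?_
  rw [coeff_schurSzego, comp_C_mul_X_coeff, coeff_map, coeff_map, Algebra.smul_def, map_div₀,
    map_mul, map_natCast]
  ring

theorem apolarPairing_map_comp_C_mul_X_ne_zero {ω : ℂ} {c : ℝ}
    (hne : (closedHalfPlane ω c).Nonempty) {F : ℂ[X]} (h : ∀ z ∈ closedHalfPlane ω c, F.eval z ≠ 0)
    {Q : ℝ[X]} (hF : F.natDegree ≤ Q.natDegree) (hQ : Q.Splits) (hQ0 : Q.coeff 0 ≠ 0) {z : ℂ}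
    (hz : ∀ r ∈ Q.roots, -(z / r) ∈ closedHalfPlane ω c) :
    apolarPairing Q.natDegree F ((Q.map (algebraMap ℝ ℂ)).comp (C z * X)) ≠ 0 := by
  rw [← natDegree_map (algebraMap ℝ ℂ)] at hF ⊢
  refine apolarPairing_comp_C_mul_X_ne_zero hne hF h ?_ ?_
  · simpa only [coeff_map, ne_eq, map_eq_zero] using hQ0
  · rw [hQ.roots_map]
    exact Multiset.forall_mem_map_iff.2 hz

theorem coeff_zero_ne_zero_of_forall_mem_roots {R : Type*} [CommRing R] [IsDomain R] {P : R[X]}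
    (hP : P ≠ 0) (h : ∀ x ∈ P.roots, x ≠ 0) : P.coeff 0 ≠ 0 := by
  rw [coeff_zero_eq_eval_zero]
  exact fun h0 => h 0 ((mem_roots hP).2 h0) rfl

theorem exists_mem_roots_of_aeval_eq_zero {K L : Type*} [Field K] [Field L] [Algebra K L]
    {P : K[X]} (hP : P.Splits) (hP0 : P ≠ 0) {z : L} (hz : aeval z P = 0) :
    ∃ x ∈ P.roots, algebraMap K L x = z := by
  have hmem : z ∈ P.aroots L := mem_aroots.2 ⟨hP0, hz⟩
  rwa [aroots, hP.roots_map, Multiset.mem_map] at hmem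

section RootLocation

open scoped ComplexOrder

theorem exists_im_neg_and_im_mul_nonneg {w : ℂ} (hw : ¬ 0 < w) :
    ∃ ω : ℂ, ω.im < 0 ∧ 0 ≤ (ω * w).im := by
  rcases eq_or_ne w.im 0 with him | him
  · have hre : w.re ≤ 0 := le_of_not_gt fun hre => hw (Complex.pos_iff.2 ⟨hre, him.symm⟩)
    exact ⟨-Complex.I, by simp, by simpa using hre⟩
  · exact ⟨(w.re / w.im : ℝ) - Complex.I, by simp,
      by simp [-Complex.ofReal_div, sub_mul, div_mul_cancel₀ _ him]⟩

theorem neg_mul_pos_of_aeval_schurSzego_eq_zero {P Q : ℝ[X]} {σ τ : ℝ}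
    (hP : P.Splits) (hP0 : P ≠ 0) (hσ : ∀ x ∈ P.roots, 0 < σ * x)
    (hQ : Q.Splits) (hQ0 : Q ≠ 0) (hτ : ∀ r ∈ Q.roots, 0 < τ * r)
    (hdeg : P.natDegree ≤ Q.natDegree) {z : ℂ} (hz : aeval z (schurSzego Q.natDegree P Q) = 0) :
    0 < -(σ * τ : ℂ) * z := by
  by_contra hpos
  obtain ⟨ω, hω, hωz⟩ := exists_im_neg_and_im_mul_nonneg hpos
  rw [aeval_schurSzego] at hz
  refine apolarPairing_map_comp_C_mul_X_ne_zero (ω := σ * ω) (c := 0) ⟨0, by simp [closedHalfPlane]⟩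
    ?_ (natDegree_map_le.trans hdeg) hQ
    (coeff_zero_ne_zero_of_forall_mem_roots hQ0 fun r hr => right_ne_zero_of_mul (hτ r hr).ne')
    ?_ hz
  · intro y hy hPy
    obtain ⟨x, hx, rfl⟩ := exists_mem_roots_of_aeval_eq_zero hP hP0 <|
      (eval_map_algebraMap P y).symm.trans hPy
    have him : (σ * ω * (x : ℂ)).im = σ * x * ω.im := by
      rw [mul_right_comm, ← Complex.ofReal_mul, Complex.im_ofReal_mul]
    exact (mul_neg_of_pos_of_neg (hσ x hx) hω).not_ge (him ▸ hy)
  · intro r hr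
    have hτr : (τ : ℂ) ≠ 0 ∧ (r : ℂ) ≠ 0 := by
      exact_mod_cast mul_ne_zero_iff.1 (hτ r hr).ne'
    have hrot : σ * ω * -(z / r) = ω * (-(σ * τ : ℂ) * z) / (τ * r : ℝ) := by
      push_cast
      field_simp [hτr.1, hτr.2]
    rw [closedHalfPlane, Set.mem_ofPred_eq, hrot, Complex.div_ofReal_im]
    exact div_nonneg hωz (hτ r hr).le

end RootLocation

theorem HasRealRootsOfSameSign.exists_abs_eq_one_and_forall_mul_pos {P : ℝ[X]}
    (hP : HasRealRootsOfSameSign P) : ∃ τ : ℝ, |τ| = 1 ∧ ∀ x ∈ P.roots, 0 < τ * x := by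
  rcases hP.same_sign with h | h
  · exact ⟨1, abs_one, by simpa using h⟩
  · exact ⟨-1, by simp, by simpa using h⟩

theorem HasRealRootsOfSameSign.of_forall_mul_pos {P : ℝ[X]} (hP0 : P ≠ 0) (hP : P.Splits) {μ : ℝ}
    (hμ : ∀ x ∈ P.roots, 0 < μ * x) : HasRealRootsOfSameSign P where
  ne_zero := hP0
  real_rooted := hP
  same_sign := (le_total 0 μ).imp (fun h x hx => pos_of_mul_pos_right (hμ x hx) h)
    fun h x hx => neg_of_mul_pos_right (hμ x hx) h

theorem HasRealRootsOfSameSign.schurSzego {P Q : ℝ[X]} (hP : HasRealRootsOfSameSign P)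
    (hQ : HasRealRootsOfSameSign Q) (hdeg : P.natDegree = Q.natDegree) :
    HasRealRootsOfSameSign (schurSzego Q.natDegree P Q) := by
  obtain ⟨σ, hσ', hσ⟩ := hP.exists_abs_eq_one_and_forall_mul_pos
  obtain ⟨τ, hτ', hτ⟩ := hQ.exists_abs_eq_one_and_forall_mul_pos
  have hμ : -(σ * τ) ≠ 0 := by simp [← abs_ne_zero (a := σ), ← abs_ne_zero (a := τ), hσ', hτ']
  have hroot {z : ℂ} (hz : aeval z (_root_.schurSzego Q.natDegree P Q) = 0) :
      ∃ x : ℝ, (x : ℂ) = z ∧ 0 < -(σ * τ) * x := by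
    have hpos := Complex.pos_iff.1 <| neg_mul_pos_of_aeval_schurSzego_eq_zero hP.real_rooted
      hP.ne_zero hσ hQ.real_rooted hQ.ne_zero hτ hdeg.le hz
    rw [← Complex.ofReal_mul, ← Complex.ofReal_neg, Complex.re_ofReal_mul, Complex.im_ofReal_mul,
      eq_comm, mul_eq_zero, or_iff_right hμ] at hpos
    exact ⟨z.re, Complex.ext rfl (by simpa using hpos.2.symm), hpos.1⟩
  refine .of_forall_mul_pos (μ := -(σ * τ)) (ne_of_apply_ne (coeff · Q.natDegree) ?_)
    (.of_splits_map (algebraMap ℝ ℂ) (IsAlgClosed.splits _) fun z hz => ?_) fun x hx => ?_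
  · exact coeff_natDegree_schurSzego_ne_zero hP.ne_zero hQ.ne_zero hdeg
  · obtain ⟨x, hxz, -⟩ := hroot (mem_aroots'.1 hz).2
    exact ⟨x, hxz⟩
  · obtain ⟨y, hyx, hy⟩ := hroot <|
      (aeval_algebraMap_eq_zero_iff ℂ x _).2 (mem_roots'.1 hx).2
    rwa [Complex.ofReal_inj.1 hyx] at hy

end SchurSzego

section HermiteBiehler

theorem aeval_add_I_mul_aeval_ne_zero {ω : ℝ} (hω : ω ≠ 0) {G P : ℝ[X]}
    (hcop : ∀ x, P.eval x = 0 → G.eval x ≠ 0)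
    (him : ∀ z : ℂ, 0 < ω * z.im → 0 < (aeval z G / aeval z P).im) {z : ℂ}
    (hz : z ∈ closedHalfPlane ω 0) : aeval z G + Complex.I * aeval z P ≠ 0 := by
  intro h0
  rw [closedHalfPlane, Set.mem_ofPred_eq, Complex.im_ofReal_mul] at hz
  rcases hz.eq_or_lt with hreal | hpos
  · obtain ⟨x, rfl⟩ : ∃ x : ℝ, (x : ℂ) = z :=
      ⟨z.re, Complex.ext rfl (mul_left_cancel₀ hω (by simpa using hreal))⟩
    rw [← Complex.coe_algebraMap, aeval_algebraMap_apply_eq_algebraMap_eval,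
      aeval_algebraMap_apply_eq_algebraMap_eval, Complex.coe_algebraMap] at h0
    exact hcop x (by simpa using congrArg Complex.im h0) (by simpa using congrArg Complex.re h0)
  · have hratio := him z hpos
    have hP : aeval z P ≠ 0 := by
      intro hP
      simp [hP] at hratio
    rw [eq_neg_of_add_eq_zero_left h0, neg_div, mul_div_cancel_right₀ _ hP] at hratio
    norm_num at hratio

/-- `G + i P` has no zero in a half-plane bounded by the real axis, so by Szegő's theorem its
pairing with `Q (x ·)` does not vanish; the two values are the real and imaginary parts of that
pairing. -/
theorem eval_schurSzego_ne_zero_of_im_div_pos {ω : ℝ} (hω : ω ≠ 0) {G P Q : ℝ[X]}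
    (hcop : ∀ x, P.eval x = 0 → G.eval x ≠ 0)
    (him : ∀ z : ℂ, 0 < ω * z.im → 0 < (aeval z G / aeval z P).im)
    (hG : G.natDegree ≤ Q.natDegree) (hP : P.natDegree ≤ Q.natDegree)
    (hQ : Q.Splits) (hQ0 : Q.coeff 0 ≠ 0) {x : ℝ}
    (hx : (schurSzego Q.natDegree P Q).eval x = 0) :
    (schurSzego Q.natDegree G Q).eval x ≠ 0 := by
  intro hx'
  refine apolarPairing_map_comp_C_mul_X_ne_zero (ω := ω) (c := 0) ⟨0, by simp [closedHalfPlane]⟩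
    (F := G.map (algebraMap ℝ ℂ) + Complex.I • P.map (algebraMap ℝ ℂ)) (fun z hz => ?_)
    (natDegree_add_le_of_degree_le (natDegree_map_le.trans hG)
      ((natDegree_smul_le _ _).trans (natDegree_map_le.trans hP))) hQ hQ0 (z := x)
    (fun r _ => ?_) ?_
  · simpa only [eval_add, eval_smul, smul_eq_mul, eval_map_algebraMap]
      using aeval_add_I_mul_aeval_ne_zero hω hcop him hz
  · rw [closedHalfPlane, Set.mem_ofPred_eq]
    norm_cast
  · rw [map_add, map_smul, LinearMap.add_apply, LinearMap.smul_apply, ← aeval_schurSzego,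
      ← aeval_schurSzego, ← Complex.coe_algebraMap, aeval_algebraMap_apply_eq_algebraMap_eval,
      aeval_algebraMap_apply_eq_algebraMap_eval, hx, hx', map_zero, smul_zero, add_zero]

end HermiteBiehler

section Dilation

theorem ne_zero_of_im_pos {z : ℂ} (hz : 0 < z.im) : z ≠ 0 :=
  fun h => hz.ne' (by rw [h, Complex.zero_im])

theorem arg_pos_of_im_pos {z : ℂ} (hz : 0 < z.im) : 0 < z.arg :=
  (Complex.arg_nonneg_iff.2 hz.le).lt_of_ne' fun h => hz.ne' (Complex.arg_eq_zero_iff.1 h).2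

theorem arg_lt_pi_of_im_pos {z : ℂ} (hz : 0 < z.im) : z.arg < Real.pi :=
  Complex.arg_lt_pi_iff.2 (Or.inr hz.ne')

theorem arg_div_of_im_pos {z w : ℂ} (hz : 0 < z.im) (hw : 0 < w.im) :
    (z / w).arg = z.arg - w.arg := by
  have hinv : w⁻¹.arg = -w.arg := by rw [Complex.arg_inv, if_neg (arg_lt_pi_of_im_pos hw).ne]
  rw [div_eq_mul_inv, (Complex.arg_mul_eq_add_arg_iff (ne_zero_of_im_pos hz)
    (inv_ne_zero (ne_zero_of_im_pos hw))).2, hinv, ← sub_eq_add_neg]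
  rw [hinv]
  constructor <;>
    linarith [arg_pos_of_im_pos hz, arg_lt_pi_of_im_pos hz, arg_pos_of_im_pos hw,
      arg_lt_pi_of_im_pos hw]

theorem strictAnti_arg_add_ofReal {z : ℂ} (hz : 0 < z.im) :
    StrictAnti fun a : ℝ => (z + a).arg := by
  intro a b hab
  have him (c : ℝ) : 0 < (z + c).im := by simpa using hz
  have hb : z + b ≠ 0 := ne_zero_of_im_pos (him b)
  have hdiv : (z + a) / (z + b) = 1 + (a - b : ℝ) * (z + b)⁻¹ := by
    field_simp
    push_cast
    ring
  rw [← sub_pos, ← arg_div_of_im_pos (him a) (him b)]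
  apply arg_pos_of_im_pos
  rw [hdiv, Complex.add_im, Complex.one_im, zero_add, Complex.im_ofReal_mul, Complex.inv_im]
  exact mul_pos_of_neg_of_neg (sub_neg.2 hab)
    (div_neg_of_neg_of_pos (neg_neg_of_pos (him b)) (Complex.normSq_pos.2 hb))

theorem sum_map_sub_le_of_pairwise {ι α : Type*} [AddCommGroup α] [LinearOrder α]
    [IsOrderedAddMonoid α] {f g : ι → α} {l : List ι} {m M : α} (hmM : m ≤ M)
    (hf : ∀ v ∈ l, f v ≤ M) (hg : ∀ v ∈ l, m ≤ g v) (hl : l.Pairwise fun u v => f v ≤ g u) :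
    (l.map fun v => f v - g v).sum ≤ M - m := by
  induction l generalizing M with
  | nil => simpa using hmM
  | cons u l ih =>
    rw [List.forall_mem_cons] at hf hg
    rw [List.pairwise_cons] at hl
    rw [List.map_cons, List.sum_cons]
    calc f u - g u + (l.map fun v => f v - g v).sum
        ≤ f u - g u + (g u - m) := by gcongr; exact ih hg.1 hl.1 hg.2 hl.2
      _ = f u - m := sub_add_sub_cancel _ _ _
      _ ≤ M - m := by gcongr; exact hf.1

theorem im_list_prod_pos_of_sum_arg {l : List ℂ} (hl : ∀ z ∈ l, z ≠ 0)
    (hpos : 0 < (l.map Complex.arg).sum) (hpi : (l.map Complex.arg).sum < Real.pi) :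
    0 < l.prod.im := by
  have hprod : l.prod = Complex.exp (l.map Complex.log).sum := by
    rw [Complex.exp_list_sum, List.map_map]
    conv_lhs => rw [← List.map_id l]
    exact congrArg List.prod (List.map_congr_left fun z hz => (Complex.exp_log (hl z hz)).symm)
  have him : (l.map Complex.log).sum.im = (l.map Complex.arg).sum := by
    rw [← Complex.coe_imAddGroupHom, map_list_sum, List.map_map]
    exact congrArg List.sum (List.map_congr_left fun z _ => Complex.log_im z)
  rw [hprod, Complex.exp_im, him]
  exact mul_pos (Real.exp_pos _) (Real.sin_pos_of_pos_of_lt_pi hpos hpi)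

/-- Each factor turns by the angle from `w + v` to `w + v / q`. By the spacing condition these
angles do not overlap inside `[0, arg w]`, so their sum is less than `π`. -/
theorem im_prod_dilate_pos {q : ℝ} (hq : 1 < q) {w : ℂ} (hw : 0 < w.im) {l : List ℝ}
    (hne : l ≠ []) (hpos : ∀ v ∈ l, 0 < v) (hl : l.Pairwise fun u v => q * u < v) :
    0 < (l.map fun v : ℝ => (q * w + v) / (w + v)).prod.im := by
  have hq0 : 0 < q := one_pos.trans hq
  have him (a : ℝ) : 0 < (w + a).im := by simpa using hw
  have hfactor (v : ℝ) : q * w + v = (q : ℂ) * (w + (v / q : ℝ)) := by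
    push_cast
    rw [mul_add, mul_div_cancel₀ _ (by exact_mod_cast hq0.ne')]
  have him' (v : ℝ) : 0 < (q * w + v).im := by simpa using mul_pos hq0 hw
  have harg (v : ℝ) : ((q * w + v) / (w + v)).arg = (w + (v / q : ℝ)).arg - (w + v).arg := by
    rw [arg_div_of_im_pos (him' v) (him v), hfactor, Complex.arg_real_mul _ hq0]
  have hanti := strictAnti_arg_add_ofReal hw
  refine im_list_prod_pos_of_sum_arg
    (List.forall_mem_map.2 fun v _ =>
      div_ne_zero (ne_zero_of_im_pos (him' v)) (ne_zero_of_im_pos (him v))) ?_ ?_ <;>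
    simp only [List.map_map, Function.comp_def, harg]
  · refine List.sum_pos _ (List.forall_mem_map.2 fun v hv => sub_pos.2 <| hanti ?_) (by simpa)
    exact div_lt_self (hpos v hv) hq
  · calc (l.map fun v : ℝ => (w + (v / q : ℝ)).arg - (w + v).arg).sum
        ≤ w.arg - 0 := sum_map_sub_le_of_pairwise (arg_pos_of_im_pos hw).le
          (fun v hv => ?_) (fun v _ => (arg_pos_of_im_pos (him v)).le)
          (hl.imp fun {u v} h => hanti.antitone ((le_div_iff₀' hq0).2 h.le))
      _ = w.arg := sub_zero _
      _ < Real.pi := arg_lt_pi_of_im_pos hw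
    simpa using hanti.antitone (div_nonneg (hpos v hv).le hq0.le)

end Dilation

section RootModuli

theorem coe_rootModuli (P : ℝ[X]) : (rootModuli P : Multiset ℝ) = P.roots.map fun x => |x| :=
  Multiset.sort_eq _ _

theorem mem_rootModuli {P : ℝ[X]} {u : ℝ} : u ∈ rootModuli P ↔ ∃ x ∈ P.roots, |x| = u := by
  rw [← Multiset.mem_coe, coe_rootModuli, Multiset.mem_map]

theorem rootModuli_pos {P : ℝ[X]} (h : ∀ x ∈ P.roots, x ≠ 0) : ∀ u ∈ rootModuli P, 0 < u := by
  intro u hu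
  obtain ⟨x, hx, rfl⟩ := mem_rootModuli.1 hu
  exact abs_pos.2 (h x hx)

theorem length_rootModuli (P : ℝ[X]) : (rootModuli P).length = P.roots.card := by
  rw [rootModuli, Multiset.length_sort, Multiset.card_map]

theorem pairwise_le_rootModuli (P : ℝ[X]) : (rootModuli P).Pairwise (· ≤ ·) :=
  Multiset.pairwise_sort _ _

theorem mul_abs_of_mul_pos {τ x : ℝ} (hτ : |τ| = 1) (hx : 0 < τ * x) : τ * |x| = x := by
  rw [← one_mul |x|, ← hτ, ← abs_mul, abs_of_pos hx, ← mul_assoc, ← abs_mul_abs_self τ, hτ,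
    one_mul, one_mul]

theorem coe_map_mul_rootModuli {P : ℝ[X]} {τ : ℝ} (hτ : |τ| = 1) (h : ∀ x ∈ P.roots, 0 < τ * x) :
    ((rootModuli P).map (τ * ·) : Multiset ℝ) = P.roots := by
  rw [← Multiset.map_coe, coe_rootModuli, Multiset.map_map]
  exact (Multiset.map_congr rfl fun x hx => mul_abs_of_mul_pos hτ (h x hx)).trans
    (Multiset.map_id _)

theorem aeval_div_aeval_eq_prod {K L : Type*} [Field K] [Field L] [Algebra K L] {P : K[X]}
    (hP : P.Splits) (hP0 : P ≠ 0) (z w : L) :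
    aeval z P / aeval w P
      = (P.roots.map fun r => (z - algebraMap K L r) / (w - algebraMap K L r)).prod := by
  have hlead : algebraMap K L P.leadingCoeff ≠ 0 := by simpa using hP0
  have hmap := hP.map (algebraMap K L)
  rw [hmap.aeval_eq_prod_aroots, hmap.aeval_eq_prod_aroots, mul_div_mul_left _ _ hlead, aroots,
    hP.roots_map, Multiset.map_map, Multiset.map_map, Multiset.prod_map_div]
  rfl

theorem aeval_comp_div_aeval_im_pos {P : ℝ[X]} (hP : P.Splits) (hdeg : P.natDegree ≠ 0) {τ : ℝ}
    (hτ : |τ| = 1) (h : ∀ x ∈ P.roots, 0 < τ * x) {q : ℝ} (hq : 1 < q)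
    (hsep : (rootModuli P).Pairwise fun u v => q * u < v) {z : ℂ} (hz : 0 < -τ * z.im) :
    0 < (aeval z (P.comp (C q * X)) / aeval z P).im := by
  have hτ0 : (-τ : ℂ) ≠ 0 := by
    rw [neg_ne_zero, Complex.ofReal_ne_zero, ← abs_ne_zero, hτ]
    exact one_ne_zero
  have hττ : (τ : ℂ) * τ = 1 := by
    rw [← Complex.ofReal_mul, ← abs_mul_abs_self, hτ, one_mul, Complex.ofReal_one]
  have hscale (y : ℂ) (v : ℝ) : -τ * (y - (τ * v : ℝ)) = -τ * y + v := by
    push_cast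
    linear_combination (v : ℂ) * hττ
  have hfactor (v : ℝ) : (q * z - (τ * v : ℝ)) / (z - (τ * v : ℝ))
      = (q * (-τ * z) + v) / (-τ * z + v) := by
    rw [← mul_div_mul_left _ _ hτ0, hscale, hscale, mul_left_comm]
  have hne : rootModuli P ≠ [] := List.ne_nil_of_length_pos <| by
    rw [length_rootModuli, ← hP.natDegree_eq_card_roots]
    exact Nat.pos_of_ne_zero hdeg
  have hprod := aeval_div_aeval_eq_prod hP (by rintro rfl; simp at hdeg) (q * z) z
  rw [← coe_map_mul_rootModuli hτ h, Multiset.map_coe, List.map_map, Multiset.prod_coe] at hprod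
  simp only [Function.comp_def, Complex.coe_algebraMap, hfactor] at hprod
  have hcomp : aeval z (P.comp (C q * X)) = aeval (q * z) P := by
    simp [aeval_comp]
  rw [hcomp, hprod]
  exact im_prod_dilate_pos hq (by rwa [← Complex.ofReal_neg, Complex.im_ofReal_mul]) hne
    (rootModuli_pos fun x hx => right_ne_zero_of_mul (h x hx).ne') hsep

theorem notMem_mul_of_pairwise_mul_lt {l : List ℝ} (hpos : ∀ u ∈ l, 0 < u) {q : ℝ} (hq : 1 < q)
    (hl : l.Pairwise fun u v => q * u < v) {u : ℝ} (hu : u ∈ l) : q * u ∉ l := by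
  intro hqu
  obtain ⟨i, hi, rfl⟩ := List.mem_iff_getElem.1 hu
  obtain ⟨j, hj, hij⟩ := List.mem_iff_getElem.1 hqu
  have hlt : l[i] < l[j] := hij ▸ lt_mul_of_one_lt_left (hpos _ hu) hq
  rw [List.pairwise_iff_getElem] at hl
  rcases lt_trichotomy i j with h | rfl | h
  · exact (hl i j hi hj h).ne hij.symm
  · exact hlt.false
  · have := hl j i hj hi h
    nlinarith [hpos _ hqu]

theorem HasRealRootsOfSameSign.forall_mem_roots_ne_zero {P : ℝ[X]}
    (hP : HasRealRootsOfSameSign P) : ∀ x ∈ P.roots, x ≠ 0 := by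
  obtain ⟨τ, -, hτ⟩ := hP.exists_abs_eq_one_and_forall_mul_pos
  exact fun x hx => right_ne_zero_of_mul (hτ x hx).ne'

theorem eval_mul_schurSzego_ne_zero {P Q : ℝ[X]} (hP : HasRealRootsOfSameSign P)
    (hPdeg : P.natDegree ≠ 0) (hPQ : P.natDegree ≤ Q.natDegree) (hQ : Q.Splits)
    (hQ0 : Q.coeff 0 ≠ 0) {q : ℝ} (hq : 1 < q)
    (hsep : (rootModuli P).Pairwise fun u v => q * u < v) {x : ℝ}
    (hx : (schurSzego Q.natDegree P Q).eval x = 0) :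
    (schurSzego Q.natDegree P Q).eval (q * x) ≠ 0 := by
  obtain ⟨τ, hτ, hτP⟩ := hP.exists_abs_eq_one_and_forall_mul_pos
  have hτ0 : -τ ≠ 0 := neg_ne_zero.2 (abs_ne_zero.1 (hτ ▸ one_ne_zero))
  have hcop (y : ℝ) (hy : P.eval y = 0) : (P.comp (C q * X)).eval y ≠ 0 := by
    intro hqy
    refine notMem_mul_of_pairwise_mul_lt (rootModuli_pos hP.forall_mem_roots_ne_zero) hq hsep
      (mem_rootModuli.2 ⟨y, (mem_roots hP.ne_zero).2 hy, rfl⟩)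
      (mem_rootModuli.2 ⟨q * y, (mem_roots hP.ne_zero).2 (by simpa using hqy), ?_⟩)
    rw [abs_mul, abs_of_pos (one_pos.trans hq)]
  have hdeg : (P.comp (C q * X)).natDegree ≤ Q.natDegree :=
    calc (P.comp (C q * X)).natDegree
        ≤ P.natDegree * (C q * X).natDegree := natDegree_comp_le
      _ ≤ P.natDegree * 1 := by gcongr; exact (natDegree_C_mul_le q X).trans natDegree_X_le
      _ ≤ Q.natDegree := by rwa [mul_one]
  have hdilate := eval_schurSzego_ne_zero_of_im_div_pos hτ0 hcop
    (fun z hz => aeval_comp_div_aeval_im_pos hP.real_rooted hPdeg hτ hτP hq hsep hz)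
    hdeg hPQ hQ hQ0 hx
  simpa [schurSzego_comp_C_mul_X] using hdilate

end RootModuli

section SimpleRoots

theorem aeval_X_mul_derivative_div_aeval {K L : Type*} [Field K] [Field L] [Algebra K L] {P : K[X]}
    (hP : P.Splits) {z : L} (hz : aeval z P ≠ 0) :
    aeval z (X * derivative P) / aeval z P
      = (P.roots.map fun r => z / (z - algebraMap K L r)).sum := by
  have hlog := (hP.map (algebraMap K L)).eval_derivative_div_eval_of_ne_zero
    (by rwa [eval_map_algebraMap])
  rw [derivative_map, eval_map_algebraMap, eval_map_algebraMap, hP.roots_map,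
    Multiset.map_map] at hlog
  rw [map_mul, aeval_X, mul_div_assoc, hlog, ← Multiset.sum_map_mul_left]
  simp only [Function.comp_def, mul_one_div]

theorem aeval_X_mul_derivative_div_aeval_im_pos {P : ℝ[X]} (hP : P.Splits) (hdeg : P.natDegree ≠ 0)
    {τ : ℝ} (h : ∀ x ∈ P.roots, 0 < τ * x) {z : ℂ} (hz : 0 < -τ * z.im) :
    0 < (aeval z (X * derivative P) / aeval z P).im := by
  have hPz : aeval z P ≠ 0 := by
    intro h0
    obtain ⟨x, -, rfl⟩ := exists_mem_roots_of_aeval_eq_zero hP (by rintro rfl; simp at hdeg) h0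
    simp at hz
  have hterm (r : ℝ) (hr : r ∈ P.roots) : 0 < (z / (z - r)).im := by
    have hzr : z - r ≠ 0 := by
      intro h0
      simp [sub_eq_zero.1 h0] at hz
    have him : (z / (z - r)).im = -(r * z.im) / Complex.normSq (z - r) := by
      rw [Complex.div_im, ← sub_div]
      congr 1
      simp
      ring
    rw [him]
    refine div_pos (pos_of_mul_pos_right (a := τ * τ) ?_ (mul_self_nonneg τ))
      (Complex.normSq_pos.2 hzr)
    linear_combination mul_pos (h r hr) hz
  rw [aeval_X_mul_derivative_div_aeval hP hPz, ← Complex.coe_imAddGroupHom, map_multiset_sum,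
    Multiset.map_map]
  simpa using Multiset.sum_lt_sum_of_nonempty (hP.roots_ne_zero hdeg) hterm

theorem nodup_roots_iff_eval_derivative_ne_zero {R : Type*} [CommRing R] [IsDomain R] {P : R[X]}
    (hP : P ≠ 0) : P.roots.Nodup ↔ ∀ x, P.eval x = 0 → (derivative P).eval x ≠ 0 := by
  classical
  simp only [Multiset.nodup_iff_count_le_one, count_roots, ← not_lt,
    one_lt_rootMultiplicity_iff_isRoot hP, IsRoot.def, not_and, ne_eq]

theorem nodup_roots_schurSzego {P Q : ℝ[X]} (hP : HasRealRootsOfSameSign P)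
    (hPdeg : P.natDegree ≠ 0) (hPQ : P.natDegree ≤ Q.natDegree) (hQ : Q.Splits)
    (hQ0 : Q.coeff 0 ≠ 0) (hnodup : P.roots.Nodup) : (schurSzego Q.natDegree P Q).roots.Nodup := by
  obtain ⟨τ, hτ, hτP⟩ := hP.exists_abs_eq_one_and_forall_mul_pos
  have hτ0 : -τ ≠ 0 := neg_ne_zero.2 (abs_ne_zero.1 (hτ ▸ one_ne_zero))
  rcases eq_or_ne (schurSzego Q.natDegree P Q) 0 with hR | hR
  · simp [hR]
  have hcop (y : ℝ) (hy : P.eval y = 0) : (X * derivative P).eval y ≠ 0 := by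
    rw [eval_mul, eval_X]
    exact mul_ne_zero (hP.forall_mem_roots_ne_zero y ((mem_roots hP.ne_zero).2 hy))
      ((nodup_roots_iff_eval_derivative_ne_zero hP.ne_zero).1 hnodup y hy)
  have hdeg : (X * derivative P).natDegree ≤ Q.natDegree := by
    refine natDegree_le_iff_coeff_eq_zero.2 fun j hj => ?_
    rw [coeff_X_mul_derivative, coeff_eq_zero_of_natDegree_lt (hPQ.trans_lt hj), mul_zero]
  refine (nodup_roots_iff_eval_derivative_ne_zero hR).2 fun x hx => ?_
  have hpair := eval_schurSzego_ne_zero_of_im_div_pos hτ0 hcop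
    (fun z hz => aeval_X_mul_derivative_div_aeval_im_pos hP.real_rooted hPdeg hτP hz)
    hdeg hPQ hQ hQ0 hx
  rw [schurSzego_X_mul_derivative, eval_mul] at hpair
  exact right_ne_zero_of_mul hpair

end SimpleRoots

section Lmesh

theorem pairwise_mul_lt_rootModuli {P : ℝ[X]} (h0 : ∀ x ∈ P.roots, x ≠ 0) {q : ℝ}
    (hq : q < lmesh P) : (rootModuli P).Pairwise fun u v => q * u < v := by
  rw [List.pairwise_iff_getElem]
  intro i j hi hj hij
  have hmesh : lmesh P ≤ (rootModuli P)[i + 1] / (rootModuli P)[i] :=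
    ciInf_le (Set.finite_range _).bddBelow (⟨i, by omega⟩ : Fin ((rootModuli P).length - 1))
  calc q * (rootModuli P)[i] < (rootModuli P)[i + 1] :=
        (lt_div_iff₀ (rootModuli_pos h0 _ (List.getElem_mem hi))).1 (hq.trans_le hmesh)
    _ ≤ (rootModuli P)[j] := (pairwise_le_rootModuli P).rel_get_of_le hij

theorem le_lmesh {P : ℝ[X]} (h0 : ∀ x ∈ P.roots, x ≠ 0) (hcard : 2 ≤ P.roots.card) {L : ℝ}
    (hL : (rootModuli P).Pairwise fun u v => L * u ≤ v) : L ≤ lmesh P := by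
  rw [← length_rootModuli] at hcard
  have : Nonempty (Fin ((rootModuli P).length - 1)) := ⟨⟨0, by omega⟩⟩
  refine le_ciInf fun ⟨i, hi⟩ => ?_
  rw [le_div_iff₀ (rootModuli_pos h0 _ (List.getElem_mem _))]
  exact List.pairwise_iff_getElem.1 hL i (i + 1) _ _ i.lt_succ_self

theorem one_le_lmesh {P : ℝ[X]} (h0 : ∀ x ∈ P.roots, x ≠ 0) (hcard : 2 ≤ P.roots.card) :
    1 ≤ lmesh P :=
  le_lmesh h0 hcard <| by simpa only [one_mul] using pairwise_le_rootModuli P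

theorem nodup_roots_of_one_lt_lmesh {P : ℝ[X]} (h0 : ∀ x ∈ P.roots, x ≠ 0) (hP : 1 < lmesh P) :
    P.roots.Nodup := by
  refine Multiset.Nodup.of_map (fun x => |x|) ?_
  rw [← coe_rootModuli, Multiset.coe_nodup]
  exact (pairwise_mul_lt_rootModuli h0 hP).imp fun h => ((one_mul _).symm.trans_lt h).ne

theorem lmesh_le_lmesh_schurSzego {P Q : ℝ[X]} (hP : HasRealRootsOfSameSign P)
    (hQ : HasRealRootsOfSameSign Q) (hdeg : P.natDegree = Q.natDegree) (hk : 2 ≤ Q.natDegree) :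
    lmesh P ≤ lmesh (schurSzego Q.natDegree P Q) := by
  have hR := hP.schurSzego hQ hdeg
  have hcard : 2 ≤ (schurSzego Q.natDegree P Q).roots.card := by
    rwa [← hR.real_rooted.natDegree_eq_card_roots, natDegree_schurSzego hP.ne_zero hQ.ne_zero hdeg]
  rcases le_or_gt (lmesh P) 1 with hle | hgt
  · exact hle.trans (one_le_lmesh hR.forall_mem_roots_ne_zero hcard)
  have hPdeg : P.natDegree ≠ 0 := by omega
  have hQ0 := coeff_zero_ne_zero_of_forall_mem_roots hQ.ne_zero hQ.forall_mem_roots_ne_zero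
  obtain ⟨ρ, hρ, hρR⟩ := hR.exists_abs_eq_one_and_forall_mul_pos
  have hroots := coe_map_mul_rootModuli hρ hρR
  have heval {u : ℝ} (hu : u ∈ rootModuli (schurSzego Q.natDegree P Q)) :
      (schurSzego Q.natDegree P Q).eval (ρ * u) = 0 :=
    (mem_roots'.1 (hroots ▸ Multiset.mem_coe.2 (List.mem_map_of_mem hu))).2
  have hnodup : (rootModuli (schurSzego Q.natDegree P Q)).Nodup := by
    have hRnodup := nodup_roots_schurSzego hP hPdeg hdeg.le hQ.real_rooted hQ0
      (nodup_roots_of_one_lt_lmesh hP.forall_mem_roots_ne_zero hgt)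
    rw [← hroots, Multiset.coe_nodup] at hRnodup
    exact hRnodup.of_map _
  refine le_lmesh hR.forall_mem_roots_ne_zero hcard <|
    (hnodup.and (pairwise_le_rootModuli _)).imp_of_mem fun {u v} hu hv huv => ?_
  by_contra! hlt
  have hu0 : 0 < u := rootModuli_pos hR.forall_mem_roots_ne_zero u hu
  have hq : 1 < v / u := (one_lt_div hu0).2 (lt_of_le_of_ne huv.2 huv.1)
  have hqL : v / u < lmesh P := (div_lt_iff₀ hu0).2 hlt
  refine eval_mul_schurSzego_ne_zero hP hPdeg hdeg.le hQ.real_rooted hQ0 hq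
    (pairwise_mul_lt_rootModuli hP.forall_mem_roots_ne_zero hqL) (heval hu) ?_
  rw [mul_left_comm, div_mul_cancel₀ _ hu0.ne']
  exact heval hv

end Lmesh

theorem mainTheorem1 (k : ℕ) (hk : 2 ≤ k) (P Q : ℝ[X])
    (hPdeg : P.natDegree = k) (hQdeg : Q.natDegree = k)
    (hP : HasRealRootsOfSameSign P) (hQ : HasRealRootsOfSameSign Q) :
    (schurSzego k P Q).natDegree = k ∧
      HasRealRootsOfSameSign (schurSzego k P Q) ∧
      max (lmesh P) (lmesh Q) ≤ lmesh (schurSzego k P Q) := by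
  subst hQdeg
  refine ⟨natDegree_schurSzego hP.ne_zero hQ.ne_zero hPdeg, hP.schurSzego hQ hPdeg,
    max_le (lmesh_le_lmesh_schurSzego hP hQ hPdeg hk) ?_⟩
  rw [schurSzego_comm, ← hPdeg]
  exact lmesh_le_lmesh_schurSzego hQ hP hPdeg.symm (hk.trans_eq hPdeg.symm)
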